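/- Let $f:\{0,1\}^n\times\{0,1\}^n\to\{0,1\}$, with sign matrix $C_f(x,y)=(-1)^{f(x,y)}$, and let $\mathbf p_f$ be the conditional distribution with $p_f(a,b\mid x,y)=\frac12$ if $ab=C_f(x,y)$ and $0$ otherwise ($a,b\in\{\pm1\}$). A conditional distribution $p(a,b\mid x,y)$ is *local* if it is a convex combination of distributions of the form $\delta_{a=u(x)}\delta_{b=v(y)}$; it is *non-signaling* if $\sum_b p(a,b\mid x,y)$ does not depend on $y$ and $\sum_a p(a,b\mid x,y)$ does not depend on $x$. For a non-signaling $\mathbf p$ put $\tilde\nu(\mathbf p)=\min\{\sum_i|q_i| : \mathbf p=\sum_i q_i\mathbf p_i,\ q_i\in\mathbb R,\ \mathbf p_i \text{ local}\}$ (finite sums), and let $\tilde\nu^\epsilon(C_f)=\min\{\tilde\nu(\mathbf p') : \mathbf p' \text{ non-signaling},\ |p_f(E\mid x,y)-p'(E\mid x,y)|\le\epsilon\ \text{for all } x,y \text{ and } E\subseteq\{\pm1\}^2\}$. In the simultaneous messages model, Alice (holding $x$) and Bob (holding $y$) each send one message to a referee, who does not see the inputs, may use private randomness, and outputs a bit,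 which must equal $f(x,y)$ with probability at least $1-\delta$ for all $x,y$. The cost is the total length of the two messages. $R^{\parallel,\mathrm{pub}}_\delta(f)$ is the minimum number of bits when Alice and Bob share randomness and send classical messages; $Q^{\parallel}_\delta(f)$ is the minimum number of qubits when they send quantum states, without shared randomness or entanglement, and the referee measures the product state. Then: 1. For all $n$ and $f$, all $0\le\epsilon<\frac12$ and all $0<\delta<\frac12$, $$R^{\parallel,\mathrm{pub}}_\delta(f)\le 4\left[\frac{\tilde\nu^\epsilon(C_f)}{1-2\epsilon}\right]^2\ln\frac1\delta .$$ 2. There is an absolute constant $K>0$ such that for all $n\ge2$, all $f$, all $0\le\epsilon<\frac12$ and all $0<\delta<\frac12$, $$Q^{\parallel}_\delta(f)\le K\,\log(n)\left[\frac{\tilde\nu^\epsilon(C_f)}{1-2\epsilon}\right]^4\ln\frac1\delta .$$ -/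

import Mathlib

open scoped Kronecker ComplexOrder ENNReal

namespace SMP

section Distributions

variable {X Y A B : Type} [Fintype X] [Fintype Y] [Fintype A] [Fintype B]

/-- A bipartite conditional family of real numbers; `p x y a b` stands for `p(a, b | x, y)`. -/
abbrev Bipartite (X Y A B : Type) : Type := X → Y → A → B → ℝ

/-- `p` is a non-signaling (conditional probability) distribution. -/
structure IsNonSignaling (p : Bipartite X Y A B) : Prop where
  nonneg : ∀ x y a b, 0 ≤ p x y a b
  sum_eq_one : ∀ x y, ∑ a, ∑ b, p x y a b = 1
  alice : ∀ a x y y', ∑ b, p x y a b = ∑ b, p x y' a b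
  bob : ∀ b x x' y, ∑ a, p x y a b = ∑ a, p x' y a b

open Classical in
/-- The local deterministic distribution in which Alice outputs `u x` and Bob outputs `v y`. -/
noncomputable def localDet (u : X → A) (v : Y → B) : Bipartite X Y A B :=
  fun x y a b => if a = u x ∧ b = v y then 1 else 0

/-- The set of local distributions: convex combinations of local deterministic ones. -/
def localSet (X Y A B : Type) : Set (Bipartite X Y A B) :=
  convexHull ℝ {p | ∃ (u : X → A) (v : Y → B), p = localDet u v}

/-- The quantity `ν̃(p)`: the least `∑ |q i|` over all ways to write `p = ∑ q i • P i`
with real coefficients `q i` and local distributions `P i`. -/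
noncomputable def nuTilde (p : Bipartite X Y A B) : ℝ :=
  sInf {t : ℝ | ∃ (m : ℕ) (q : Fin m → ℝ) (P : Fin m → Bipartite X Y A B),
    (∀ i, P i ∈ localSet X Y A B) ∧ p = ∑ i, q i • P i ∧ t = ∑ i, |q i|}

/-- The total variation distance: the maximum over inputs `(x, y)` and events `E ⊆ A × B` of
`|p(E | x, y) - p'(E | x, y)|`. -/
noncomputable def tvDist (p p' : Bipartite X Y A B) : ℝ :=
  ⨆ i : X × Y × Finset (A × B),
    |∑ e ∈ i.2.2, p i.1 i.2.1 e.1 e.2 - ∑ e ∈ i.2.2, p' i.1 i.2.1 e.1 e.2|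

/-- The quantity `ν̃^ε(p)`: the least `ν̃(p')` over non-signaling distributions `p'` within
total variation distance `ε` of `p`. -/
noncomputable def nuTildeApprox (ε : ℝ) (p : Bipartite X Y A B) : ℝ :=
  sInf {t : ℝ | ∃ p' : Bipartite X Y A B,
    IsNonSignaling p' ∧ tvDist p p' ≤ ε ∧ t = nuTilde p'}

end Distributions

section BooleanFunctions

variable {X Y : Type}

/-- The sign matrix `C_f(x, y) = (-1)^{f(x, y)}`, with entries in `{1, -1} = ℤˣ`. -/
def signMatrix (f : X → Y → Bool) : X → Y → ℤˣ :=
  fun x y => if f x y then -1 else 1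

/-- The distribution `(C, 0, 0)` with outcomes in `{1, -1}`, uniform marginals and
correlations given by the sign matrix `C`. -/
noncomputable def signDist (C : X → Y → ℤˣ) : Bipartite X Y ℤˣ ℤˣ :=
  fun x y a b => if C x y = a * b then 1 / 2 else 0

/-- `ν̃^ε(C)` for a sign matrix `C`. -/
noncomputable def nuTildeApproxSign [Fintype X] [Fintype Y] (ε : ℝ) (C : X → Y → ℤˣ) : ℝ :=
  nuTildeApprox ε (signDist C)

end BooleanFunctions

section Protocols

/-- A simultaneous messages protocol with shared (public) randomness. Alice and Bob share a
random variable `r` with law `μ` on a finite set and send `cA`, respectively `cB`, bits to the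
referee. The referee sees the two messages only, and outputs the bit `b` with probability
`out mA mB b`, using private randomness. -/
structure PubProtocol (X Y : Type) (cA cB : ℕ) where
  k : ℕ
  μ : Fin k → ℝ
  μ_nonneg : ∀ r, 0 ≤ μ r
  μ_sum : ∑ r, μ r = 1
  msgA : Fin k → X → (Fin cA → Bool)
  msgB : Fin k → Y → (Fin cB → Bool)
  out : (Fin cA → Bool) → (Fin cB → Bool) → Bool → ℝ
  out_nonneg : ∀ mA mB b, 0 ≤ out mA mB b
  out_sum : ∀ mA mB, ∑ b, out mA mB b = 1

/-- The probability that the referee outputs `b` on inputs `(x, y)`. -/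
def PubProtocol.prob {X Y : Type} {cA cB : ℕ} (P : PubProtocol X Y cA cB)
    (x : X) (y : Y) (b : Bool) : ℝ :=
  ∑ r, P.μ r * P.out (P.msgA r x) (P.msgB r y) b

/-- The protocol outputs `f x y` with probability at least `1 - δ` on all inputs. -/
def PubProtocol.Computes {X Y : Type} {cA cB : ℕ} (P : PubProtocol X Y cA cB)
    (f : X → Y → Bool) (δ : ℝ) : Prop :=
  ∀ x y, 1 - δ ≤ P.prob x y (f x y)

/-- The complexity `R^{∥,pub}_δ(f)`: the least total number of bits sent to the referee in a
public-coin simultaneous messages protocol for `f` with error at most `δ`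
(`⊤` if there were no protocol). -/
noncomputable def pubSMP {X Y : Type} (δ : ℝ) (f : X → Y → Bool) : ℕ∞ :=
  sInf {c : ℕ∞ | ∃ (cA cB : ℕ) (P : PubProtocol X Y cA cB),
    P.Computes f δ ∧ c = ((cA + cB : ℕ) : ℕ∞)}

/-- The computational basis of a register of `q` qubits is indexed by `q`-bit strings. -/
abbrev Qubits (q : ℕ) : Type := Fin q → Bool

/-- A quantum simultaneous messages protocol without shared randomness or entanglement. Alice and
Bob send to the referee states (density matrices) of `qA`, respectively `qB`, qubits that depend
on their own input only. The referee measures the product state jointly by a two-outcome POVM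
and outputs the outcome. -/
structure QuantumProtocol (X Y : Type) (qA qB : ℕ) where
  stateA : X → Matrix (Qubits qA) (Qubits qA) ℂ
  stateB : Y → Matrix (Qubits qB) (Qubits qB) ℂ
  stateA_pos : ∀ x, (stateA x).PosSemidef
  stateA_trace : ∀ x, (stateA x).trace = 1
  stateB_pos : ∀ y, (stateB y).PosSemidef
  stateB_trace : ∀ y, (stateB y).trace = 1
  povm : Bool → Matrix (Qubits qA × Qubits qB) (Qubits qA × Qubits qB) ℂ
  povm_pos : ∀ b, (povm b).PosSemidef
  povm_sum : ∑ b, povm b = 1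

/-- The probability that the referee outputs `b` on inputs `(x, y)` (Born rule). -/
noncomputable def QuantumProtocol.prob {X Y : Type} {qA qB : ℕ} (P : QuantumProtocol X Y qA qB)
    (x : X) (y : Y) (b : Bool) : ℝ :=
  (Matrix.trace (P.povm b * (P.stateA x ⊗ₖ P.stateB y))).re

/-- The protocol outputs `f x y` with probability at least `1 - δ` on all inputs. -/
def QuantumProtocol.Computes {X Y : Type} {qA qB : ℕ} (P : QuantumProtocol X Y qA qB)
    (f : X → Y → Bool) (δ : ℝ) : Prop :=
  ∀ x y, 1 - δ ≤ P.prob x y (f x y)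

/-- The complexity `Q^∥_δ(f)`: the least total number of qubits sent to the referee in a quantum
simultaneous messages protocol for `f` with error at most `δ` (`⊤` if there were no protocol). -/
noncomputable def quantumSMP {X Y : Type} (δ : ℝ) (f : X → Y → Bool) : ℕ∞ :=
  sInf {c : ℕ∞ | ∃ (qA qB : ℕ) (P : QuantumProtocol X Y qA qB),
    P.Computes f δ ∧ c = ((qA + qB : ℕ) : ℕ∞)}

end Protocols

end SMP

/-! A non-signaling `p'` within `ε` of the sign distribution satisfies `ab = C_f(x, y)` with
probability at least `1 - ε`. If `p' = ∑ c d • localDet d.1 d.2`, then `∑ c d = 1` and the signed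
combination of the products `d.1 x * d.2 y` agrees with `C_f` with correlation at least `1 - 2ε`.
Drawing `d` with probability `|c d| / W`, where `W = ∑ |c d|`, and letting Alice flip her bit when
`c d < 0`, gives a shared-coin strategy with one bit per player whose parity is `f x y` with bias at
least `(1 - 2ε) / Λ` for any `Λ ≥ W` (`hasXorSampling_of_nuTildeApproxSign_lt`). Both bounds start
from this strategy.

Public coins: repeat the strategy and let the referee take a majority vote of the parities. The vote
over `m` rounds errs with probability at most `exp (-m t² / 2) / 2` (`le_sum_majority`); the
constant 4 depends on the factor `1 / 2` there, which pays for rounding `m` down.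

Quantum messages: a Chernoff and union bound fixes `N = O(n / t²)` values of the coins that work for
all inputs at once (`exists_samples`). Each player sends a superposition of a reference state and of
the `N` signs it would have sent. An exchange observable between the reference and sign parts has
expectation linear in the inner product of the two sign vectors, so the sign of the bias survives,
which the square measured by the usual swap test would lose. A majority vote over independent copies
then amplifies the bias. A copy has `O(log n + log (1 / t))` qubits, and `O(t⁻² log (1 / δ))` copies
suffice. -/

namespace SMP

/-! ### Error of a majority vote -/

section Majority

/-- The number of positions at which the word `w` has the letter `b`. -/
def letterCount {m : ℕ} (w : Fin m → Bool) (b : Bool) : ℕ :=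
  (Finset.univ.filter fun k => w k = b).card

/-- The probability that a majority vote over the word `w`, with fair tie-breaking, returns `b`. -/
noncomputable def majority {m : ℕ} (w : Fin m → Bool) (b : Bool) : ℝ :=
  if letterCount w (!b) < letterCount w b then 1
  else if letterCount w b < letterCount w (!b) then 0 else 1 / 2

lemma majority_nonneg {m : ℕ} (w : Fin m → Bool) (b : Bool) : 0 ≤ majority w b := by
  unfold majority
  split_ifs <;> norm_num

lemma majority_add {m : ℕ} (w : Fin m → Bool) (b : Bool) :
    majority w b + majority w (!b) = 1 := by
  unfold majority
  rw [Bool.not_not]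
  split_ifs <;> first | omega | norm_num

lemma sum_majority {m : ℕ} (w : Fin m → Bool) : ∑ b, majority w b = 1 := by
  rw [Fintype.sum_bool]
  exact majority_add w true

lemma letterCount_not {m : ℕ} (w : Fin m → Bool) (b : Bool) :
    letterCount (fun k => !w k) b = letterCount w (!b) := by
  unfold letterCount
  congr 1
  ext k
  cases h : w k <;> cases b <;> simp [h]

lemma majority_not {m : ℕ} (w : Fin m → Bool) (b : Bool) :
    majority (fun k => !w k) b = majority w (!b) := by
  unfold majority
  simp only [letterCount_not]

lemma prod_letters {m : ℕ} (p : Bool → ℝ) (w : Fin m → Bool) (b : Bool) :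
    ∏ k, p (w k) = p b ^ letterCount w b * p (!b) ^ letterCount w (!b) := by
  have h : ∀ k, p (w k) = (if w k = b then p b else 1) * (if w k = !b then p (!b) else 1) := by
    intro k
    cases h : w k <;> cases b <;> simp
  rw [Finset.prod_congr rfl fun k _ => h k, Finset.prod_mul_distrib, Finset.prod_ite,
    Finset.prod_ite]
  simp [letterCount]

lemma pow_mul_pow_le_of_le {x y : ℝ} (hy : 0 ≤ y) (hyx : y ≤ x) {i j : ℕ} (hij : j ≤ i) :
    x ^ j * y ^ i ≤ x ^ i * y ^ j := by
  obtain ⟨d, rfl⟩ := Nat.exists_eq_add_of_le hij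
  have hx := hy.trans hyx
  calc x ^ j * y ^ (j + d) = x ^ j * y ^ j * y ^ d := by ring
    _ ≤ x ^ j * y ^ j * x ^ d := by gcongr
    _ = x ^ (j + d) * y ^ j := by ring

lemma le_sqrt_mul {x y : ℝ} (hx : 0 ≤ x) (hxy : x ≤ y) : x ≤ √(x * y) := by
  apply Real.le_sqrt_of_sq_le
  nlinarith

lemma sum_prod_words (m : ℕ) (p : Bool → ℝ) :
    ∑ w : Fin m → Bool, ∏ k, p (w k) = (∑ b, p b) ^ m := by
  have h := Finset.prod_univ_sum (fun _ : Fin m => (Finset.univ : Finset Bool)) fun _ b => p b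
  rw [Fintype.piFinset_univ] at h
  rw [← h]
  simp

/-- A majority vote over `m` independent letters that are right with bias at least `t` errs with
probability at most `exp (-m t² / 2) / 2`. -/
lemma le_sum_majority {m : ℕ} {p : Bool → ℝ} (hp : ∀ b, 0 ≤ p b) (hp1 : ∑ b, p b = 1) {t : ℝ}
    (ht : 0 ≤ t) {b : Bool} (hb : t ≤ p b - p (!b)) :
    1 - Real.exp (-(m * t ^ 2) / 2) / 2 ≤ ∑ w : Fin m → Bool, (∏ k, p (w k)) * majority w b := by
  set P : (Fin m → Bool) → ℝ := fun w => ∏ k, p (w k) with hP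
  have hP0 : ∀ w, 0 ≤ P w := fun w => Finset.prod_nonneg fun k _ => hp _
  have hsum : p b + p (!b) = 1 := by
    rw [← hp1, Fintype.sum_bool]
    cases b
    · exact add_comm _ _
    · rfl
  have htot : ∑ w, P w = 1 := by
    rw [hP, sum_prod_words, hp1, one_pow]
  set s : ℝ := √(p b * p (!b)) with hs
  have hs0 : 0 ≤ s := Real.sqrt_nonneg _
  -- At each position a word and its complement carry both letters, so the product of their
  -- probabilities does not depend on the word.
  have hgeom : ∀ w, √(P w * P fun k => !w k) = s ^ m := by
    intro w
    have : (P w * P fun k => !w k) = (s ^ m) ^ 2 := by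
      rw [hP]
      simp only
      rw [← Finset.prod_mul_distrib, ← pow_mul, mul_comm m 2, pow_mul,
        Real.sq_sqrt (mul_nonneg (hp _) (hp _))]
      rw [Finset.prod_congr rfl (g := fun _ => p b * p (!b))]
      · simp
      · intro k _
        cases w k <;> cases b <;> simp [mul_comm]
    rw [this, Real.sqrt_sq (by positivity)]
  -- Exactly one of `w` and its complement has a wrong majority, apart from ties, and it is the less
  -- likely of the two. Its probability is therefore at most their geometric mean; a tie gives
  -- equality.
  have hpt : ∀ w, P w * majority w (!b) + P (fun k => !w k) * majority w b ≤ s ^ m := by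
    intro w
    have h1 : P w = p b ^ letterCount w b * p (!b) ^ letterCount w (!b) := prod_letters p w b
    have h2 : P (fun k => !w k) = p b ^ letterCount w (!b) * p (!b) ^ letterCount w b := by
      rw [hP]
      simp only
      rw [prod_letters p (fun k => !w k) b, letterCount_not, letterCount_not, Bool.not_not]
    have hle : p (!b) ≤ p b := by linarith
    rw [← hgeom w]
    unfold majority
    rw [Bool.not_not]
    rcases lt_trichotomy (letterCount w (!b)) (letterCount w b) with h | h | h
    · rw [if_neg (by omega), if_pos h, if_pos h, mul_zero, zero_add, mul_one, mul_comm (P w)]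
      refine le_sqrt_mul (hP0 _) ?_
      rw [h1, h2]
      exact pow_mul_pow_le_of_le (hp _) hle h.le
    · have : P (fun k => !w k) = P w := by rw [h1, h2, h]
      simp only [h, lt_irrefl, if_false, this]
      rw [Real.sqrt_mul_self (hP0 w)]
      linarith
    · rw [if_pos h, if_neg (by omega), if_pos h, mul_zero, add_zero, mul_one]
      refine le_sqrt_mul (hP0 _) ?_
      rw [h1, h2]
      exact pow_mul_pow_le_of_le (hp _) hle h.le
  have hflip : ∑ w, P w * majority w (!b) = ∑ w, P (fun k => !w k) * majority w b := by
    refine (Equiv.sum_comp (Equiv.arrowCongr (Equiv.refl (Fin m)) Equiv.boolNot) _).symm.trans ?_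
    refine Finset.sum_congr rfl fun w _ => ?_
    have : (Equiv.arrowCongr (Equiv.refl (Fin m)) Equiv.boolNot) w = fun k => !w k := rfl
    rw [this, majority_not, Bool.not_not]
  -- Summing the pairwise bound over all `2 ^ m` words counts the error twice, hence the factor `1 /
  -- 2`.
  have herr : ∑ w, P w * majority w (!b) ≤ (2 * s) ^ m / 2 := by
    have h := Finset.sum_le_sum fun w (_ : w ∈ Finset.univ) => hpt w
    rw [Finset.sum_add_distrib, ← hflip] at h
    simp only [Finset.sum_const, Finset.card_univ, Fintype.card_fun, Fintype.card_bool,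
      Fintype.card_fin, nsmul_eq_mul] at h
    push_cast at h
    rw [← mul_pow] at h
    linarith
  -- With `p b + p (!b) = 1`, `4 * p b * p (!b) = 1 - (p b - p (!b)) ^ 2 ≤ 1 - t ^ 2 ≤ exp (-t ^
  -- 2)`.
  have hs1 : 2 * s ≤ Real.exp (-t ^ 2 / 2) := by
    have h4 : 2 * s = √(4 * (p b * p (!b))) := by
      rw [Real.sqrt_mul (by norm_num), hs, show (4 : ℝ) = 2 ^ 2 by norm_num,
        Real.sqrt_sq (by norm_num)]
    rw [h4, Real.sqrt_le_left (Real.exp_pos _).le, ← Real.exp_nat_mul]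
    have := Real.add_one_le_exp (-t ^ 2)
    have e : ((2 : ℕ) : ℝ) * (-t ^ 2 / 2) = -t ^ 2 := by push_cast; ring
    rw [e]
    nlinarith
  have hpow : (2 * s) ^ m ≤ Real.exp (-(m * t ^ 2) / 2) := by
    calc (2 * s) ^ m ≤ Real.exp (-t ^ 2 / 2) ^ m := by gcongr
      _ = Real.exp (-(m * t ^ 2) / 2) := by
        rw [← Real.exp_nat_mul]
        congr 1
        ring
  have hcomb : ∑ w, P w * majority w b = 1 - ∑ w, P w * majority w (!b) := by
    rw [eq_sub_iff_add_eq, ← Finset.sum_add_distrib, ← htot]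
    refine Finset.sum_congr rfl fun w _ => ?_
    rw [← mul_add, majority_add, mul_one]
  rw [hcomb]
  linarith

/-- A function of the letters of independent samples depends only on the law of a letter. -/
lemma sum_samples_eq_sum_words {Ω : Type} [Fintype Ω] {m : ℕ} (μ : Ω → ℝ) (g : Ω → Bool)
    (F : (Fin m → Bool) → ℝ) :
    ∑ r : Fin m → Ω, (∏ k, μ (r k)) * F (fun k => g (r k)) =
      ∑ w : Fin m → Bool, (∏ k, ∑ ω, if g ω = w k then μ ω else 0) * F w := by
  have h : ∀ w : Fin m → Bool, (∏ k, ∑ ω, if g ω = w k then μ ω else 0) =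
      ∑ r : Fin m → Ω, if (fun k => g (r k)) = w then ∏ k, μ (r k) else 0 := by
    intro w
    have := Finset.prod_univ_sum (fun _ : Fin m => (Finset.univ : Finset Ω))
      fun k ω => if g ω = w k then μ ω else 0
    rw [Fintype.piFinset_univ] at this
    rw [this]
    refine Finset.sum_congr rfl fun r _ => ?_
    rw [Finset.prod_ite_zero]
    simp [funext_iff]
  simp_rw [h, Finset.sum_mul]
  rw [Finset.sum_comm]
  simp [ite_mul]

end Majority

/-! ### Repeated one-bit strategies with shared coins -/

section PublicCoins

variable {X Y : Type}

/-- There is a public-coin protocol for `f` in which the players send one bit each, whose parity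
is `f x y` with bias at least `t`. -/
def HasXorSampling (f : X → Y → Bool) (t : ℝ) : Prop :=
  ∃ (Ω : Type) (_ : Fintype Ω) (μ : Ω → ℝ) (a : Ω → X → Bool) (b : Ω → Y → Bool),
    (∀ r, 0 ≤ μ r) ∧ ∑ r, μ r = 1 ∧
      ∀ x y, t ≤ ∑ r, μ r * (if (a r x ^^ b r y) = f x y then 1 else -1)

lemma pubSMP_le_of_hasXorSampling {f : X → Y → Bool} {t δ : ℝ} (ht : 0 ≤ t)
    (hf : HasXorSampling f t) {m : ℕ} (hδ : Real.exp (-(m * t ^ 2) / 2) / 2 ≤ δ) :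
    pubSMP δ f ≤ ((m + m : ℕ) : ℕ∞) := by
  classical
  obtain ⟨Ω, _, μ, a, b, hμ, hμ1, hbias⟩ := hf
  let e : (Fin m → Ω) ≃ Fin (Fintype.card (Fin m → Ω)) := Fintype.equivFin _
  let P : PubProtocol X Y m m :=
    { k := Fintype.card (Fin m → Ω)
      μ := fun r => ∏ k, μ (e.symm r k)
      μ_nonneg := fun r => Finset.prod_nonneg fun k _ => hμ _
      μ_sum := by
        rw [Equiv.sum_comp e.symm fun r => ∏ k, μ (r k)]
        have := Finset.prod_univ_sum (fun _ : Fin m => (Finset.univ : Finset Ω)) fun _ ω => μ ω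
        rw [Fintype.piFinset_univ] at this
        rw [← this]
        simp [hμ1]
      msgA := fun r x k => a (e.symm r k) x
      msgB := fun r y k => b (e.symm r k) y
      out := fun u v => majority fun k => u k ^^ v k
      out_nonneg := fun _ _ _ => majority_nonneg _ _
      out_sum := fun _ _ => sum_majority _ }
  refine sInf_le ⟨m, m, P, fun x y => ?_, rfl⟩
  have hprob : P.prob x y (f x y) = ∑ r : Fin m → Ω, (∏ k, μ (r k)) *
      majority (fun k => a (r k) x ^^ b (r k) y) (f x y) :=
    Equiv.sum_comp e.symm fun r : Fin m → Ω => (∏ k, μ (r k)) *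
      majority (fun k => a (r k) x ^^ b (r k) y) (f x y)
  rw [hprob, sum_samples_eq_sum_words μ (fun r => a r x ^^ b r y) fun w => majority w (f x y)]
  refine le_trans (by linarith) (le_sum_majority (p := fun c => ∑ ω,
    if (a ω x ^^ b ω y) = c then μ ω else 0) (fun c => ?_) ?_ ht (b := f x y) ?_)
  · exact Finset.sum_nonneg fun ω _ => by split_ifs <;> simp [hμ]
  · rw [Finset.sum_comm]
    simpa only [Finset.sum_ite_eq, Finset.mem_univ, if_true] using hμ1
  · refine (hbias x y).trans (le_of_eq ?_)
    rw [← Finset.sum_sub_distrib]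
    refine Finset.sum_congr rfl fun ω _ => ?_
    cases h : (a ω x ^^ b ω y) <;> cases f x y <;> simp

end PublicCoins

/-! ### Signed combinations of local deterministic strategies -/

section LocalDecomposition

variable {X Y A B : Type}

lemma sum_event_localDet (E : Finset (A × B)) (u : X → A) (v : Y → B) (x : X) (y : Y)
    [DecidableEq A] [DecidableEq B] :
    ∑ e ∈ E, localDet u v x y e.1 e.2 = if (u x, v y) ∈ E then 1 else 0 := by
  have : ∀ e : A × B, localDet u v x y e.1 e.2 = if (u x, v y) = e then 1 else 0 := by
    intro e
    have h : (u x, v y) = e ↔ e.1 = u x ∧ e.2 = v y := by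
      rw [Prod.ext_iff]
      exact and_congr eq_comm eq_comm
    simp [localDet, h]
  simp_rw [this]
  rw [Finset.sum_ite_eq]

variable [Fintype X] [Fintype Y] [Fintype A] [Fintype B]

lemma abs_event_sub_le_tvDist (p p' : Bipartite X Y A B) (x : X) (y : Y) (E : Finset (A × B)) :
    |∑ e ∈ E, p x y e.1 e.2 - ∑ e ∈ E, p' x y e.1 e.2| ≤ tvDist p p' :=
  le_ciSup (f := fun i : X × Y × Finset (A × B) =>
    |∑ e ∈ i.2.2, p i.1 i.2.1 e.1 e.2 - ∑ e ∈ i.2.2, p' i.1 i.2.1 e.1 e.2|)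
    (Set.finite_range _).bddAbove (x, y, E)

variable [DecidableEq X] [DecidableEq Y]

lemma exists_weights_of_mem_localSet {p : Bipartite X Y A B} (hp : p ∈ localSet X Y A B) :
    ∃ c : (X → A) × (Y → B) → ℝ, (∀ d, 0 ≤ c d) ∧ ∑ d, c d = 1 ∧
      p = ∑ d, c d • localDet d.1 d.2 := by
  classical
  refine convexHull_min (t := {p : Bipartite X Y A B | ∃ c : (X → A) × (Y → B) → ℝ,
    (∀ d, 0 ≤ c d) ∧ ∑ d, c d = 1 ∧ p = ∑ d, c d • localDet d.1 d.2}) ?_ ?_ hp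
  · rintro _ ⟨u, v, rfl⟩
    refine ⟨Pi.single (u, v) 1, fun d => ?_, by simp, ?_⟩
    · by_cases h : d = (u, v)
      · subst h; simp
      · simp [h]
    · simp [Pi.single_apply, ite_smul]
  · rintro _ ⟨c, hc, hc1, rfl⟩ _ ⟨c', hc', hc1', rfl⟩ s t hs ht hst
    refine ⟨fun d => s * c d + t * c' d, fun d => ?_, ?_, ?_⟩
    · have := hc d
      have := hc' d
      positivity
    · rw [Finset.sum_add_distrib, ← Finset.mul_sum, ← Finset.mul_sum, hc1, hc1', mul_one, mul_one,
        hst]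
    · simp_rw [add_smul, mul_smul]
      rw [Finset.sum_add_distrib, ← Finset.smul_sum, ← Finset.smul_sum]

/-- Each local term is expanded over the finite set of deterministic strategies and coefficients are
collected. Cancellation can only lower the total absolute weight. -/
lemma exists_weights_of_sum_local {m : ℕ} (q : Fin m → ℝ) {P : Fin m → Bipartite X Y A B}
    (hP : ∀ i, P i ∈ localSet X Y A B) :
    ∃ c : (X → A) × (Y → B) → ℝ, ∑ d, |c d| ≤ ∑ i, |q i| ∧
      ∑ i, q i • P i = ∑ d, c d • localDet d.1 d.2 := by
  choose c hc hc1 hPc using fun i => exists_weights_of_mem_localSet (hP i)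
  refine ⟨fun d => ∑ i, q i * c i d, ?_, ?_⟩
  · calc ∑ d, |∑ i, q i * c i d| ≤ ∑ d, ∑ i, |q i| * c i d := by
          refine Finset.sum_le_sum fun d _ => (Finset.abs_sum_le_sum_abs _ _).trans ?_
          refine Finset.sum_le_sum fun i _ => ?_
          rw [abs_mul, abs_of_nonneg (hc i d)]
      _ = ∑ i, |q i| := by
          rw [Finset.sum_comm]
          simp_rw [← Finset.mul_sum, hc1, mul_one]
  · simp_rw [Finset.sum_smul]
    rw [Finset.sum_comm]
    refine Finset.sum_congr rfl fun i _ => ?_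
    rw [hPc i, Finset.smul_sum]
    simp_rw [mul_smul]

lemma sum_event_weights [DecidableEq A] [DecidableEq B] (c : (X → A) × (Y → B) → ℝ)
    (E : Finset (A × B)) (x : X) (y : Y) :
    ∑ e ∈ E, (∑ d, c d • localDet d.1 d.2 : Bipartite X Y A B) x y e.1 e.2 =
      ∑ d, c d * if (d.1 x, d.2 y) ∈ E then 1 else 0 := by
  simp only [Finset.sum_apply, Pi.smul_apply, smul_eq_mul]
  rw [Finset.sum_comm]
  refine Finset.sum_congr rfl fun d _ => ?_
  rw [← Finset.mul_sum, sum_event_localDet]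

/-- Normalization at any one input pair forces this, since every deterministic strategy has total
mass one there. -/
lemma sum_weights_eq_one [Nonempty X] [Nonempty Y] {c : (X → A) × (Y → B) → ℝ}
    (h : IsNonSignaling (∑ d, c d • localDet d.1 d.2 : Bipartite X Y A B)) : ∑ d, c d = 1 := by
  classical
  obtain ⟨x⟩ := ‹Nonempty X›
  obtain ⟨y⟩ := ‹Nonempty Y›
  rw [← h.sum_eq_one x y, ← Fintype.sum_prod_type'
    (f := (∑ d, c d • localDet d.1 d.2 : Bipartite X Y A B) x y), sum_event_weights]
  simp

end LocalDecomposition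

/-! ### Non-signaling distributions with binary outcomes lie in the span of the local ones -/

section BinaryOutcomes

variable {X Y : Type}

/-- The product of a family on Alice's side and a family on Bob's side, as a bilinear map. -/
def productFamily (X Y A B : Type) :
    (X → A → ℝ) →ₗ[ℝ] (Y → B → ℝ) →ₗ[ℝ] Bipartite X Y A B :=
  LinearMap.mk₂ ℝ (fun g h x y a b => g x a * h y b)
    (fun _ _ _ => by ext; exact add_mul _ _ _)
    (fun _ _ _ => by ext; exact mul_assoc _ _ _)
    (fun _ _ _ => by ext; exact mul_add _ _ _)
    (fun _ _ _ => by ext; exact mul_left_comm _ _ _)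

/-- The deterministic family with outcome `u x` on input `x`. -/
def deterministic (u : X → ℤˣ) : X → ℤˣ → ℝ := fun x a => if a = u x then 1 else 0

lemma productFamily_deterministic (u : X → ℤˣ) (v : Y → ℤˣ) :
    productFamily X Y ℤˣ ℤˣ (deterministic u) (deterministic v) = localDet u v := by
  ext x y a b
  simp only [productFamily, LinearMap.mk₂_apply, deterministic, localDet]
  by_cases h : a = u x <;> by_cases h' : b = v y <;> simp [h, h']

lemma const_mem_span_deterministic (X : Type) :
    (fun _ _ => 1 : X → ℤˣ → ℝ) ∈ Submodule.span ℝ (Set.range (deterministic (X := X))) := by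
  have h : (fun _ _ => 1 : X → ℤˣ → ℝ) = deterministic (fun _ => 1) + deterministic fun _ => -1 := by
    ext x a
    rcases Int.units_eq_one_or a with rfl | rfl <;> simp [deterministic]
  rw [h]
  exact Submodule.add_mem _ (Submodule.subset_span ⟨_, rfl⟩) (Submodule.subset_span ⟨_, rfl⟩)

variable [Fintype X] [DecidableEq X]

lemma sign_mul_mem_span_deterministic (α : X → ℝ) :
    (fun x a => ((a : ℤ) : ℝ) * α x : X → ℤˣ → ℝ) ∈
      Submodule.span ℝ (Set.range (deterministic (X := X))) := by
  -- Two deterministic strategies that differ only at the input `z` have difference `a` at `z` and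
  -- zero elsewhere.
  have h : (fun x a => ((a : ℤ) : ℝ) * α x : X → ℤˣ → ℝ) = ∑ z, α z •
      (deterministic (fun _ => 1) - deterministic fun x => if x = z then -1 else 1) := by
    ext x a
    simp only [Finset.sum_apply, Pi.smul_apply, Pi.sub_apply, smul_eq_mul]
    rw [Finset.sum_eq_single x]
    · rcases Int.units_eq_one_or a with rfl | rfl <;> simp [deterministic]
    · intro z _ hz
      simp [deterministic, hz.symm]
    · simp
  rw [h]
  exact Submodule.sum_mem _ fun z _ => Submodule.smul_mem _ _ <| Submodule.sub_mem _
    (Submodule.subset_span ⟨_, rfl⟩) (Submodule.subset_span ⟨_, rfl⟩)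

variable [Fintype Y] [DecidableEq Y]

/-- Every non-signaling distribution with binary outcomes is a real combination of local
deterministic ones. -/
lemma IsNonSignaling.exists_weights [Nonempty X] [Nonempty Y] {p : Bipartite X Y ℤˣ ℤˣ}
    (hp : IsNonSignaling p) :
    ∃ c : (X → ℤˣ) × (Y → ℤˣ) → ℝ, p = ∑ d, c d • localDet d.1 d.2 := by
  obtain ⟨x₀⟩ := ‹Nonempty X›
  obtain ⟨y₀⟩ := ‹Nonempty Y›
  set S : Submodule ℝ (Bipartite X Y ℤˣ ℤˣ) := Submodule.span ℝ
    (Set.range fun d : (X → ℤˣ) × (Y → ℤˣ) => localDet d.1 d.2) with hS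
  have hprod : ∀ g ∈ Submodule.span ℝ (Set.range (deterministic (X := X))),
      ∀ h ∈ Submodule.span ℝ (Set.range (deterministic (X := Y))),
        productFamily X Y ℤˣ ℤˣ g h ∈ S := by
    intro g hg h hh
    have := Submodule.apply_mem_map₂ (productFamily X Y ℤˣ ℤˣ) hg hh
    rw [Submodule.map₂_span_span] at this
    refine Submodule.span_mono ?_ this
    rintro _ ⟨_, ⟨u, rfl⟩, _, ⟨v, rfl⟩, rfl⟩
    exact ⟨(u, v), (productFamily_deterministic u v).symm⟩
  -- Fourier expansion in the outcomes: `4 p(a, b | x, y) = 1 + a A(x) + b B(y) + ab C(x, y)`. By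
  -- non-signaling the marginal biases `A` and `B` may be read off at the fixed inputs `y₀` and
  -- `x₀`; the correlation matrix `C` is split into its rows to become a sum of products.
  have hdecomp : p = (1 / 4 : ℝ) • (productFamily X Y ℤˣ ℤˣ (fun _ _ => 1) (fun _ _ => 1)
      + productFamily X Y ℤˣ ℤˣ
        (fun x a => ((a : ℤ) : ℝ) * (∑ b, p x y₀ 1 b - ∑ b, p x y₀ (-1) b)) (fun _ _ => 1)
      + productFamily X Y ℤˣ ℤˣ (fun _ _ => 1)
        (fun y b => ((b : ℤ) : ℝ) * (∑ a, p x₀ y a 1 - ∑ a, p x₀ y a (-1)))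
      + ∑ z, productFamily X Y ℤˣ ℤˣ (fun x a => ((a : ℤ) : ℝ) * if x = z then 1 else 0)
        (fun y b => ((b : ℤ) : ℝ) * (p z y 1 1 - p z y 1 (-1) - p z y (-1) 1 + p z y (-1) (-1))))
      := by
    ext x y a b
    have h1 := hp.sum_eq_one x y
    have h2 := hp.alice 1 x y y₀
    have h3 := hp.alice (-1) x y y₀
    have h4 := hp.bob 1 x x₀ y
    have h5 := hp.bob (-1) x x₀ y
    simp only [Pi.smul_apply, Pi.add_apply, Finset.sum_apply, smul_eq_mul, productFamily,
      LinearMap.mk₂_apply]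
    rw [Finset.sum_eq_single x (fun z _ hz => by simp [hz.symm]) (by simp), ← h2, ← h3, ← h4, ← h5]
    have hu : (Finset.univ : Finset ℤˣ) = {1, -1} := rfl
    have hne : (1 : ℤˣ) ≠ -1 := by decide
    simp only [hu, Finset.sum_pair hne] at h1 ⊢
    rcases Int.units_eq_one_or a with rfl | rfl <;> rcases Int.units_eq_one_or b with rfl | rfl <;>
      simp <;> linarith
  have hmem : p ∈ S := by
    rw [hdecomp]
    refine S.smul_mem _ (S.add_mem (S.add_mem (S.add_mem ?_ ?_) ?_) (S.sum_mem fun z _ => ?_)) <;>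
      refine hprod _ ?_ _ ?_ <;>
      first
        | exact const_mem_span_deterministic _
        | exact sign_mul_mem_span_deterministic _
  obtain ⟨c, hc⟩ := (Submodule.mem_span_range_iff_exists_fun ℝ).1 hmem
  exact ⟨c, hc.symm⟩

/-- Needed because `sInf` of the empty set is `0`: without it a bound on `nuTilde p` would yield no
decomposition. -/
lemma nuTilde_set_nonempty [Nonempty X] [Nonempty Y] {p : Bipartite X Y ℤˣ ℤˣ}
    (hp : IsNonSignaling p) :
    {t : ℝ | ∃ (m : ℕ) (q : Fin m → ℝ) (P : Fin m → Bipartite X Y ℤˣ ℤˣ),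
      (∀ i, P i ∈ localSet X Y ℤˣ ℤˣ) ∧ p = ∑ i, q i • P i ∧ t = ∑ i, |q i|}.Nonempty := by
  obtain ⟨c, hc⟩ := hp.exists_weights
  let e := (Fintype.equivFin ((X → ℤˣ) × (Y → ℤˣ))).symm
  refine ⟨_, _, fun i => c (e i), fun i => localDet (e i).1 (e i).2,
    fun i => subset_convexHull _ _ ⟨_, _, rfl⟩, ?_, rfl⟩
  rw [hc]
  exact (Equiv.sum_comp e fun d => c d • localDet d.1 d.2).symm

lemma one_le_nuTilde [Nonempty X] [Nonempty Y] {p : Bipartite X Y ℤˣ ℤˣ} (hp : IsNonSignaling p) :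
    1 ≤ nuTilde p := by
  refine le_csInf (nuTilde_set_nonempty hp) ?_
  rintro _ ⟨m, q, P, hP, rfl, rfl⟩
  obtain ⟨c, hc, hcP⟩ := exists_weights_of_sum_local q hP
  rw [hcP] at hp
  rw [← sum_weights_eq_one hp]
  exact (Finset.sum_le_sum fun d _ => le_abs_self (c d)).trans hc

end BinaryOutcomes

/-! ### From an approximation of the sign distribution to a biased one-bit strategy -/

section SignMatrices

variable {X Y : Type}

lemma isNonSignaling_signDist (C : X → Y → ℤˣ) : IsNonSignaling (signDist C) := by
  have hu : (Finset.univ : Finset ℤˣ) = {1, -1} := rfl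
  have hne : (1 : ℤˣ) ≠ -1 := by decide
  have hne' : (-1 : ℤˣ) ≠ 1 := by decide
  refine ⟨fun x y a b => ?_, fun x y => ?_, fun a x y y' => ?_, fun b x x' y => ?_⟩
  · unfold signDist
    split_ifs <;> norm_num
  · simp only [hu, Finset.sum_pair hne, signDist]
    rcases Int.units_eq_one_or (C x y) with h | h <;> simp [h, hne, hne'] <;> norm_num
  · simp only [hu, Finset.sum_pair hne, signDist]
    rcases Int.units_eq_one_or (C x y) with h | h <;>
      rcases Int.units_eq_one_or (C x y') with h' | h' <;>
      rcases Int.units_eq_one_or a with rfl | rfl <;> simp [h, h', hne, hne']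
  · simp only [hu, Finset.sum_pair hne, signDist]
    rcases Int.units_eq_one_or (C x y) with h | h <;>
      rcases Int.units_eq_one_or (C x' y) with h' | h' <;>
      rcases Int.units_eq_one_or b with rfl | rfl <;> simp [h, h', hne, hne']

lemma sum_event_signDist (C : X → Y → ℤˣ) (x : X) (y : Y) :
    ∑ e : ℤˣ × ℤˣ with e.1 * e.2 = C x y, signDist C x y e.1 e.2 = 1 := by
  have hu : (Finset.univ : Finset ℤˣ) = {1, -1} := rfl
  have hne : (1 : ℤˣ) ≠ -1 := by decide
  have hne' : (-1 : ℤˣ) ≠ 1 := by decide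
  rw [Finset.sum_filter, Fintype.sum_prod_type]
  simp only [hu, Finset.sum_pair hne, signDist]
  rcases Int.units_eq_one_or (C x y) with h | h <;> simp [h, hne, hne'] <;> norm_num

lemma nuTildeApproxSign_set_nonempty {ε : ℝ} (hε : 0 ≤ ε) (C : X → Y → ℤˣ) :
    {t : ℝ | ∃ p' : Bipartite X Y ℤˣ ℤˣ,
      IsNonSignaling p' ∧ tvDist (signDist C) p' ≤ ε ∧ t = nuTilde p'}.Nonempty := by
  refine ⟨_, signDist C, isNonSignaling_signDist C, ?_, rfl⟩
  simpa [tvDist] using hε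

variable [Fintype X] [Fintype Y] [DecidableEq X] [DecidableEq Y] [Nonempty X] [Nonempty Y]

lemma one_le_nuTildeApproxSign {ε : ℝ} (hε : 0 ≤ ε) (C : X → Y → ℤˣ) :
    1 ≤ nuTildeApproxSign ε C := by
  refine le_csInf (nuTildeApproxSign_set_nonempty hε C) ?_
  rintro _ ⟨p', hp', -, rfl⟩
  exact one_le_nuTilde hp'

lemma exists_weights_of_nuTildeApproxSign_lt {ε Λ : ℝ} (hε : 0 ≤ ε) {C : X → Y → ℤˣ}
    (hΛ : nuTildeApproxSign ε C < Λ) :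
    ∃ c : (X → ℤˣ) × (Y → ℤˣ) → ℝ, ∑ d, |c d| ≤ Λ ∧ ∑ d, c d = 1 ∧
      ∀ x y, 1 - 2 * ε ≤ ∑ d, c d * if d.1 x * d.2 y = C x y then 1 else -1 := by
  obtain ⟨_, ⟨p, hp, hpε, rfl⟩, hlt⟩ :=
    exists_lt_of_csInf_lt (nuTildeApproxSign_set_nonempty hε C) hΛ
  obtain ⟨_, ⟨m, q, P, hP, rfl, rfl⟩, hlt'⟩ := exists_lt_of_csInf_lt (nuTilde_set_nonempty hp) hlt
  obtain ⟨c, hc, hcP⟩ := exists_weights_of_sum_local q hP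
  rw [hcP] at hp hpε
  have hc1 := sum_weights_eq_one hp
  refine ⟨c, hc.trans hlt'.le, hc1, fun x y => ?_⟩
  -- The event `ab = C x y` is certain under `signDist C`, so it has mass at least `1 - ε` under the
  -- approximation; with `∑ c d = 1` this becomes correlation at least `2 (1 - ε) - 1`.
  have h := (abs_event_sub_le_tvDist (signDist C) (∑ d, c d • localDet d.1 d.2) x y
    (Finset.univ.filter fun e => e.1 * e.2 = C x y)).trans hpε
  rw [sum_event_signDist, sum_event_weights] at h
  simp only [Finset.mem_filter, Finset.mem_univ, true_and] at h
  have h' : ∑ d, c d * (if d.1 x * d.2 y = C x y then 1 else -1 : ℝ) =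
      2 * ∑ d, c d * (if d.1 x * d.2 y = C x y then 1 else 0 : ℝ) - ∑ d, c d := by
    rw [Finset.mul_sum, ← Finset.sum_sub_distrib]
    refine Finset.sum_congr rfl fun d _ => ?_
    split_ifs <;> ring
  rw [h', hc1]
  linarith [(abs_le.1 h).2]

/-- Signed combinations of local strategies are sampled with bias inversely proportional to their
total weight. -/
lemma hasXorSampling_of_nuTildeApproxSign_lt {ε Λ : ℝ} (hε : 0 ≤ ε) (hε' : ε < 1 / 2)
    {f : X → Y → Bool} (hΛ : nuTildeApproxSign ε (signMatrix f) < Λ) :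
    HasXorSampling f ((1 - 2 * ε) / Λ) := by
  obtain ⟨c, hcΛ, hc1, hc⟩ := exists_weights_of_nuTildeApproxSign_lt hε hΛ
  set W := ∑ d, |c d| with hW
  have hW1 : 1 ≤ W := hc1 ▸ Finset.sum_le_sum fun d _ => le_abs_self (c d)
  have hne : (1 : ℤˣ) ≠ -1 := by decide
  have hne' : (-1 : ℤˣ) ≠ 1 := by decide
  -- The sign of a coefficient cannot be part of a probability, so it is moved into Alice's bit.
  refine ⟨(X → ℤˣ) × (Y → ℤˣ), inferInstance, fun d => |c d| / W,
    fun d x => decide (d.1 x = -1) ^^ decide (c d < 0), fun d y => decide (d.2 y = -1),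
    fun d => by positivity, ?_, fun x y => ?_⟩
  · rw [← Finset.sum_div, ← hW, div_self (by positivity)]
  · calc (1 - 2 * ε) / Λ ≤ (1 - 2 * ε) / W := by
          apply div_le_div_of_nonneg_left _ _ hcΛ <;> linarith
      _ ≤ (∑ d, c d * if d.1 x * d.2 y = signMatrix f x y then 1 else -1) / W := by
          gcongr
          exact hc x y
      _ = _ := by
          rw [Finset.sum_div]
          refine Finset.sum_congr rfl fun d _ => ?_
          rw [div_mul_eq_mul_div]
          congr 1
          rcases lt_or_ge (c d) 0 with h | h <;>
            rcases Int.units_eq_one_or (d.1 x) with h1 | h1 <;>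
            rcases Int.units_eq_one_or (d.2 y) with h2 | h2 <;> cases h3 : f x y <;>
            simp [signMatrix, h, h1, h2, h3, hne, hne', abs_of_neg, abs_of_nonneg, not_lt.2]

end SignMatrices

/-! ### Derandomization by a Chernoff and union bound -/

section Sampling

/-- Finitely many samples suffice for all empirical means to exceed half of the common lower bound
on the means. -/
lemma exists_samples {Ω Z ι : Type} [Fintype Ω] [Fintype Z] [Fintype ι] {μ : Ω → ℝ}
    (hμ : ∀ r, 0 ≤ μ r) (hμ1 : ∑ r, μ r = 1) {z : Ω → Z → ℝ} (hz : ∀ r j, |z r j| ≤ 1) {t : ℝ}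
    (ht : 0 < t) (ht1 : t ≤ 1) (hmean : ∀ j, t ≤ ∑ r, μ r * z r j)
    (hcard : Fintype.card Z * Real.exp (-(t ^ 2 / 16)) ^ Fintype.card ι < 1) :
    ∃ r : ι → Ω, ∀ j, Fintype.card ι * (t / 2) < ∑ i, z (r i) j := by
  classical
  -- Exponential moment with parameter `t / 4`. By `exp s ≤ 1 + s + s²` for `|s| ≤ 1`, its mean is
  -- at most `exp (t² / 8) * (1 - t² / 4 + t² / 16) ≤ exp (-t² / 16)`.
  set φ : Ω → Z → ℝ := fun ω j => Real.exp (-(t / 4) * (z ω j - t / 2)) with hφ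
  have hone : ∀ j, ∑ ω, μ ω * φ ω j ≤ Real.exp (-(t ^ 2 / 16)) := by
    intro j
    have hle : ∀ ω, φ ω j ≤ Real.exp (t ^ 2 / 8) * (1 - t / 4 * z ω j + (t / 4) ^ 2) := by
      intro ω
      have he : φ ω j = Real.exp (t ^ 2 / 8) * Real.exp (-(t / 4) * z ω j) := by
        rw [← Real.exp_add]
        simp only [hφ]
        ring_nf
      have habs : |-(t / 4) * z ω j| ≤ t / 4 := by
        rw [abs_mul, abs_neg, abs_of_pos (by positivity)]
        exact mul_le_of_le_one_right (by positivity) (hz ω j)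
      have h1 := (abs_le.1 (Real.abs_exp_sub_one_sub_id_le (habs.trans (by linarith)))).2
      have h2 : (-(t / 4) * z ω j) ^ 2 ≤ (t / 4) ^ 2 := by
        rw [← sq_abs]
        gcongr
      rw [he]
      gcongr
      linarith
    calc ∑ ω, μ ω * φ ω j
        ≤ ∑ ω, μ ω * (Real.exp (t ^ 2 / 8) * (1 - t / 4 * z ω j + (t / 4) ^ 2)) :=
          Finset.sum_le_sum fun ω _ => mul_le_mul_of_nonneg_left (hle ω) (hμ ω)
      _ = Real.exp (t ^ 2 / 8) * ((1 + (t / 4) ^ 2) * ∑ ω, μ ω - t / 4 * ∑ ω, μ ω * z ω j) := by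
          rw [Finset.mul_sum, Finset.mul_sum, ← Finset.sum_sub_distrib, Finset.mul_sum]
          exact Finset.sum_congr rfl fun ω _ => by ring
      _ ≤ Real.exp (t ^ 2 / 8) * Real.exp (-(3 * t ^ 2 / 16)) := by
          gcongr
          rw [hμ1]
          have := Real.add_one_le_exp (-(3 * t ^ 2 / 16))
          nlinarith [mul_le_mul_of_nonneg_left (hmean j) ht.le]
      _ = Real.exp (-(t ^ 2 / 16)) := by
          rw [← Real.exp_add]
          congr 1
          ring
  have hprod : ∀ g : Ω → ℝ, ∑ r : ι → Ω, ∏ i, g (r i) = (∑ ω, g ω) ^ Fintype.card ι := by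
    intro g
    have := Finset.prod_univ_sum (fun _ : ι => (Finset.univ : Finset Ω)) fun _ ω => g ω
    rw [Fintype.piFinset_univ] at this
    rw [← this]
    simp
  have hμφ : ∑ r : ι → Ω, (∏ i, μ (r i)) * ∑ j, ∏ i, φ (r i) j < 1 := by
    refine lt_of_le_of_lt ?_ hcard
    simp_rw [Finset.mul_sum, ← Finset.prod_mul_distrib]
    rw [Finset.sum_comm, Finset.sum_congr rfl fun j _ => hprod fun ω => μ ω * φ ω j]
    calc ∑ j, (∑ ω, μ ω * φ ω j) ^ Fintype.card ι
        ≤ ∑ _j : Z, Real.exp (-(t ^ 2 / 16)) ^ Fintype.card ι := by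
          refine Finset.sum_le_sum fun j _ => pow_le_pow_left₀ ?_ (hone j) _
          exact Finset.sum_nonneg fun ω _ => mul_nonneg (hμ ω) (Real.exp_pos _).le
      _ = _ := by simp
  -- The mean over samples is below `1`, so some sample is too. Each of its products is then below
  -- `1`, which says that each empirical mean exceeds `t / 2`.
  obtain ⟨r, hr⟩ : ∃ r : ι → Ω, ∑ j, ∏ i, φ (r i) j < 1 := by
    by_contra! h
    refine absurd hμφ (not_lt.2 ?_)
    calc (1 : ℝ) = ∑ r : ι → Ω, ∏ i, μ (r i) := by rw [hprod, hμ1, one_pow]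
      _ ≤ _ := Finset.sum_le_sum fun r _ =>
        le_mul_of_one_le_right (Finset.prod_nonneg fun i _ => hμ _) (h r)
  refine ⟨r, fun j => ?_⟩
  have h1 : ∏ i, φ (r i) j < 1 := lt_of_le_of_lt (Finset.single_le_sum
    (f := fun j => ∏ i, φ (r i) j)
    (fun j _ => Finset.prod_nonneg fun i _ => (Real.exp_pos _).le) (Finset.mem_univ j)) hr
  rw [hφ, ← Real.exp_sum, Real.exp_lt_one_iff, ← Finset.mul_sum, Finset.sum_sub_distrib] at h1
  simp only [Finset.sum_const, Finset.card_univ, nsmul_eq_mul] at h1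
  nlinarith

end Sampling

/-! ### Tensor products of finitely many matrices -/

section TensorPower

lemma sum_pi_prod {m : ℕ} {ι : Type} [Fintype ι] (g : Fin m → ι → ℂ) :
    ∑ r : Fin m → ι, ∏ k, g k (r k) = ∏ k, ∑ i, g k i := by
  classical
  have := Finset.prod_univ_sum (fun _ : Fin m => (Finset.univ : Finset ι)) g
  rw [Fintype.piFinset_univ] at this
  exact this.symm

variable {m : ℕ} {K : Type}

/-- The tensor product of `m` matrices. -/
def tensor (M : Fin m → Matrix K K ℂ) : Matrix (Fin m → K) (Fin m → K) ℂ :=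
  Matrix.of fun i j => ∏ k, M k (i k) (j k)

lemma sum_tensor [DecidableEq K] {M : Bool → Matrix K K ℂ} (hM : ∑ b, M b = 1) :
    ∑ w : Fin m → Bool, tensor (fun k => M (w k)) = 1 := by
  ext i j
  rw [Matrix.sum_apply]
  simp only [tensor, Matrix.of_apply]
  rw [sum_pi_prod fun k b => M b (i k) (j k)]
  simp_rw [← Matrix.sum_apply, hM, Matrix.one_apply]
  rw [Finset.prod_ite_zero]
  simp [funext_iff]

variable [Fintype K]

lemma tensor_mul (M N : Fin m → Matrix K K ℂ) :
    tensor M * tensor N = tensor fun k => M k * N k := by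
  ext i j
  simp only [tensor, Matrix.mul_apply, Matrix.of_apply, ← Finset.prod_mul_distrib]
  exact sum_pi_prod fun k l => M k (i k) l * N k l (j k)

-- Factoring each `M k` as `(B k)ᴴ * B k` makes the tensor product `(tensor B)ᴴ * tensor B`.
open scoped MatrixOrder Matrix.Norms.L2Operator in
lemma tensor_posSemidef [DecidableEq K] {M : Fin m → Matrix K K ℂ} (hM : ∀ k, (M k).PosSemidef) :
    (tensor M).PosSemidef := by
  choose B hB using fun k => CStarAlgebra.nonneg_iff_eq_star_mul_self.mp (hM k).nonneg
  have h : tensor M = (tensor B).conjTranspose * tensor B := by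
    have : (tensor B).conjTranspose = tensor fun k => (B k).conjTranspose := by
      ext i j
      simp [tensor, Matrix.conjTranspose_apply]
    rw [this, tensor_mul]
    congr 1
    exact funext hB
  rw [h]
  exact Matrix.posSemidef_conjTranspose_mul_self _

/-- The value of the quadratic form of a product operator at a product vector. -/
lemma trace_tensor_mul_vecMulVec (M : Fin m → Matrix K K ℂ) (ψ : K → ℂ) :
    (tensor M * Matrix.vecMulVec (fun I : Fin m → K => ∏ k, ψ (I k))
      (star fun I : Fin m → K => ∏ k, ψ (I k))).trace =
      ∏ k, (M k * Matrix.vecMulVec ψ (star ψ)).trace := by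
  have h : Matrix.vecMulVec (fun I : Fin m → K => ∏ k, ψ (I k)) (star fun I => ∏ k, ψ (I k)) =
      tensor fun _ => Matrix.vecMulVec ψ (star ψ) := by
    ext i j
    simp [tensor, Matrix.vecMulVec_apply, Finset.prod_mul_distrib]
  rw [h, tensor_mul]
  simp only [tensor, Matrix.trace, Matrix.diag_apply, Matrix.of_apply]
  exact sum_pi_prod fun k i => (M k * Matrix.vecMulVec ψ (star ψ)) i i

end TensorPower

/-! ### Parallel repetition of a quantum measurement with a majority vote -/

section Repetition

variable {X Y : Type} {J : Type} [Fintype J]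

lemma sum_prod_star_mul {m : ℕ} {α : J → ℂ} (hα : ∑ i, α i * star (α i) = 1) :
    (Matrix.vecMulVec (fun I : Fin m → J => ∏ k, α (I k)) (star fun I => ∏ k, α (I k))).trace
      = 1 := by
  simp only [Matrix.trace, Matrix.diag_apply, Matrix.vecMulVec_apply, Pi.star_apply, star_prod,
    ← Finset.prod_mul_distrib]
  rw [sum_pi_prod fun _ i => α i * star (α i), hα]
  simp

variable [DecidableEq J]

/-- Repeating a two-outcome measurement of pure product states and taking a majority vote. -/
lemma exists_protocol_majority {m q : ℕ} (hJ : Fintype.card J = 2 ^ q) {α : X → J → ℂ}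
    {β : Y → J → ℂ} (hα : ∀ x, ∑ i, α x i * star (α x i) = 1)
    (hβ : ∀ y, ∑ i, β y i * star (β y i) = 1) {M : Bool → Matrix (J × J) (J × J) ℂ}
    (hM : ∀ b, (M b).PosSemidef) (hM1 : ∑ b, M b = 1) {p : X → Y → Bool → ℝ}
    (hp : ∀ x y b, (M b * Matrix.vecMulVec (fun i : J × J => α x i.1 * β y i.2)
      (star fun i : J × J => α x i.1 * β y i.2)).trace = p x y b) :
    ∃ P : QuantumProtocol X Y (m * q) (m * q),
      ∀ x y b, P.prob x y b = ∑ w : Fin m → Bool, (∏ k, p x y (w k)) * majority w b := by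
  have e : Qubits (m * q) ≃ (Fin m → J) := Fintype.equivOfCardEq (by
    simp [hJ, ← pow_mul, mul_comm])
  -- Regroups Alice's `m` registers and Bob's `m` registers into `m` pairs, one for each copy of the
  -- measurement.
  let E : Qubits (m * q) × Qubits (m * q) ≃ (Fin m → J × J) :=
    (e.prodCongr e).trans (Equiv.arrowProdEquivProdArrow (Fin m) (fun _ => J) fun _ => J).symm
  have hE : ∀ i k, E i k = (e i.1 k, e i.2 k) := fun i k => rfl
  -- Measuring all copies and then voting is itself a POVM: each outcome word is weighted by the
  -- probability that its vote returns `b`.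
  let T : Bool → Matrix (Fin m → J × J) (Fin m → J × J) ℂ := fun b =>
    ∑ w : Fin m → Bool, (majority w b : ℂ) • tensor fun k => M (w k)
  let ρ : (J → ℂ) → Matrix (Qubits (m * q)) (Qubits (m * q)) ℂ := fun a =>
    (Matrix.vecMulVec (fun I : Fin m → J => ∏ k, a (I k))
      (star fun I => ∏ k, a (I k))).submatrix e e
  have hρ : ∀ a, (ρ a).PosSemidef := fun a => (Matrix.posSemidef_vecMulVec_self_star _).submatrix e
  have htr : ∀ {I I' : Type} [Fintype I] [Fintype I'] (g : I ≃ I') (A : Matrix I' I' ℂ),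
      (A.submatrix g g).trace = A.trace := fun g A => Equiv.sum_comp g fun i => A i i
  have hρ1 : ∀ a : J → ℂ, ∑ i, a i * star (a i) = 1 → (ρ a).trace = 1 := fun a ha => by
    rw [htr, sum_prod_star_mul ha]
  let P : QuantumProtocol X Y (m * q) (m * q) :=
    { stateA := fun x => ρ (α x)
      stateB := fun y => ρ (β y)
      stateA_pos := fun x => hρ _
      stateA_trace := fun x => hρ1 _ (hα x)
      stateB_pos := fun y => hρ _
      stateB_trace := fun y => hρ1 _ (hβ y)
      povm := fun b => (T b).submatrix E E
      povm_pos := fun b => by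
        refine Matrix.PosSemidef.submatrix (Matrix.posSemidef_sum _ fun w _ => ?_) E
        refine (tensor_posSemidef fun k => hM _).smul ?_
        exact_mod_cast majority_nonneg w b
      povm_sum := by
        have hT : ∑ b, T b = 1 := by
          rw [Finset.sum_comm, ← sum_tensor hM1]
          refine Finset.sum_congr rfl fun w _ => ?_
          rw [← Finset.sum_smul, ← Complex.ofReal_sum, sum_majority, Complex.ofReal_one, one_smul]
        rw [Fintype.sum_bool] at hT ⊢
        change (T true + T false).submatrix E E = 1
        rw [hT, Matrix.submatrix_one_equiv] }
  refine ⟨P, fun x y b => ?_⟩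
  set ψ : J × J → ℂ := fun i => α x i.1 * β y i.2 with hψ
  have hstate : ρ (α x) ⊗ₖ ρ (β y) = (Matrix.vecMulVec (fun I : Fin m → J × J => ∏ k, ψ (I k))
      (star fun I => ∏ k, ψ (I k))).submatrix E E := by
    ext i j
    simp only [ρ, Matrix.kroneckerMap_apply, Matrix.submatrix_apply, Matrix.vecMulVec_apply,
      Pi.star_apply, hE, hψ, Finset.prod_mul_distrib, star_mul']
    ring
  have htrace : (T b * Matrix.vecMulVec (fun I : Fin m → J × J => ∏ k, ψ (I k))
      (star fun I => ∏ k, ψ (I k))).trace =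
      ((∑ w : Fin m → Bool, (∏ k, p x y (w k)) * majority w b : ℝ) : ℂ) := by
    simp only [T, Finset.sum_mul, Matrix.trace_sum, Matrix.smul_mul, Matrix.trace_smul]
    push_cast
    refine Finset.sum_congr rfl fun w _ => ?_
    rw [trace_tensor_mul_vecMulVec, smul_eq_mul, mul_comm, Finset.prod_congr rfl]
    exact fun k _ => hp x y (w k)
  change (((T b).submatrix E E * (ρ (α x) ⊗ₖ ρ (β y))).trace).re = _
  rw [hstate, Matrix.submatrix_mul_equiv, htr, htrace, Complex.ofReal_re]

end Repetition

/-! ### The exchange observable and the sign states -/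

section Exchange

/-- The eigenvalues of `H` are among `-1, 0, 1`. The proof avoids the spectrum through the sum of
squares `1 + H = (1 - H²)² + (H² + H)² / 2`. -/
lemma posSemidef_one_add_of_cube_eq {K : Type} [Fintype K] [DecidableEq K] {H : Matrix K K ℂ}
    (hH : H.IsHermitian) (h3 : H * H * H = H) : (1 + H).PosSemidef := by
  have hA : (1 - H * H).conjTranspose = 1 - H * H := by
    rw [Matrix.conjTranspose_sub, Matrix.conjTranspose_mul, hH.eq, Matrix.conjTranspose_one]
  have hB : (H * H + H).conjTranspose = H * H + H := by
    rw [Matrix.conjTranspose_add, Matrix.conjTranspose_mul, hH.eq]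
  have h4 : H * H * H * H = H * H := by rw [h3]
  have hAA : (1 - H * H) * (1 - H * H) = 1 - H * H := by
    have : (1 - H * H) * (1 - H * H) = 1 - H * H - H * H + H * H * H * H := by noncomm_ring
    rw [this, h4]
    abel
  have hBB : (H * H + H) * (H * H + H) = (2 : ℂ) • (H * H + H) := by
    have : (H * H + H) * (H * H + H) = H * H * H * H + H * H * H + H * H * H + H * H := by
      noncomm_ring
    rw [this, h4, h3, two_smul]
    abel
  have h : 1 + H = (1 - H * H).conjTranspose * (1 - H * H) +
      (1 / 2 : ℂ) • ((H * H + H).conjTranspose * (H * H + H)) := by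
    rw [hA, hB, hAA, hBB, smul_smul]
    norm_num
    abel
  rw [h]
  refine (Matrix.posSemidef_conjTranspose_mul_self _).add
    ((Matrix.posSemidef_conjTranspose_mul_self _).smul ?_)
  rw [show (1 / 2 : ℂ) = ((1 / 2 : ℝ) : ℂ) by push_cast; rfl]
  exact_mod_cast (by norm_num : (0 : ℝ) ≤ 1 / 2)

variable {ι : Type} [DecidableEq ι]

/-- The swap of two registers, restricted to the pairs of basis states of which exactly one is the
distinguished state `none`. -/
def exchange (ι : Type) [DecidableEq ι] :
    Matrix (Option ι × Option ι) (Option ι × Option ι) ℂ :=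
  Matrix.of fun i j => if (i.1.isNone ^^ i.2.isNone) ∧ j = i.swap then 1 else 0

lemma exchange_isHermitian : (exchange ι).IsHermitian := by
  ext ⟨i, i'⟩ ⟨j, j'⟩
  have h : ((j.isNone ^^ j'.isNone) ∧ (i, i') = (j, j').swap) ↔
      ((i.isNone ^^ i'.isNone) ∧ (j, j') = (i, i').swap) := by
    simp only [Prod.swap_prod_mk, Prod.mk.injEq]
    constructor <;> rintro ⟨h, rfl, rfl⟩ <;> exact ⟨by rwa [Bool.xor_comm], rfl, rfl⟩
  simp only [exchange, Matrix.conjTranspose_apply, Matrix.of_apply, h]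
  split_ifs <;> simp

variable [Fintype ι]

lemma exchange_mul_apply (A : Matrix (Option ι × Option ι) (Option ι × Option ι) ℂ)
    (i j : Option ι × Option ι) :
    (exchange ι * A) i j = if i.1.isNone ^^ i.2.isNone then A i.swap j else 0 := by
  simp only [Matrix.mul_apply, exchange, Matrix.of_apply]
  generalize (i.1.isNone ^^ i.2.isNone) = c
  cases c <;> simp

/-- The swap preserves the condition that exactly one register is `none`, so `exchange` squares to
the projection onto those pairs. -/
lemma exchange_cube : exchange ι * exchange ι * exchange ι = exchange ι := by
  ext i j
  rw [mul_assoc, exchange_mul_apply, exchange_mul_apply]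
  have hs : (i.swap.1.isNone ^^ i.swap.2.isNone) = (i.1.isNone ^^ i.2.isNone) :=
    Bool.xor_comm _ _
  rw [hs, Prod.swap_swap]
  simp only [exchange, Matrix.of_apply]
  generalize (i.1.isNone ^^ i.2.isNone) = c
  cases c <;> simp

/-- The sign `(-1)^b`. -/
def bitSign (b : Bool) : ℝ := if b then -1 else 1

lemma bitSign_mul_self (b : Bool) : bitSign b * bitSign b = 1 := by
  cases b <;> simp [bitSign]

/-- The two-outcome measurement of the observable `exchange`. -/
noncomputable def exchangeMeasurement (ι : Type) [Fintype ι] [DecidableEq ι] (b : Bool) :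
    Matrix (Option ι × Option ι) (Option ι × Option ι) ℂ :=
  (1 / 2 : ℂ) • (1 + (bitSign b : ℂ) • exchange ι)

lemma exchangeMeasurement_posSemidef (b : Bool) : (exchangeMeasurement ι b).PosSemidef := by
  refine (posSemidef_one_add_of_cube_eq ?_ ?_).smul ?_
  · rw [Matrix.IsHermitian, Matrix.conjTranspose_smul, exchange_isHermitian.eq]
    simp
  · have h : (bitSign b : ℂ) * bitSign b = 1 := by exact_mod_cast bitSign_mul_self b
    simp only [Matrix.smul_mul, Matrix.mul_smul, exchange_cube, smul_smul]
    rw [h, mul_one]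
  · rw [show (1 / 2 : ℂ) = ((1 / 2 : ℝ) : ℂ) by push_cast; rfl]
    exact_mod_cast (by norm_num : (0 : ℝ) ≤ 1 / 2)

lemma sum_exchangeMeasurement : ∑ b, exchangeMeasurement ι b = 1 := by
  rw [Fintype.sum_bool]
  simp only [exchangeMeasurement, bitSign]
  ext i j
  simp
  ring

/-- The state with amplitude `√(1/2)` at the distinguished basis state and amplitudes proportional
to the signs of `u` elsewhere. -/
noncomputable def signState (u : ι → Bool) : Option ι → ℂ :=
  fun o => o.elim ((√(1 / 2) : ℝ) : ℂ)
    fun i => ((bitSign (u i) * √(1 / (2 * Fintype.card ι)) : ℝ) : ℂ)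

omit [DecidableEq ι] in
lemma sum_signState [Nonempty ι] (u : ι → Bool) :
    ∑ i, signState u i * star (signState u i) = 1 := by
  have hN : (Fintype.card ι : ℝ) ≠ 0 := by exact_mod_cast Fintype.card_ne_zero
  have h : ∀ i, bitSign (u i) * √(1 / (2 * Fintype.card ι)) *
      (bitSign (u i) * √(1 / (2 * Fintype.card ι))) = 1 / (2 * Fintype.card ι) := by
    intro i
    rw [mul_mul_mul_comm, bitSign_mul_self, Real.mul_self_sqrt (by positivity), one_mul]
  simp only [Fintype.sum_option, signState, Option.elim, Complex.star_def, Complex.conj_ofReal,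
    ← Complex.ofReal_mul, h]
  rw [Real.mul_self_sqrt (by norm_num), ← Complex.ofReal_sum, ← Complex.ofReal_add,
    Complex.ofReal_eq_one, Finset.sum_const, Finset.card_univ, nsmul_eq_mul]
  field_simp
  norm_num

/-- The observable pairs the amplitudes at `(none, i)` and `(i, none)`, so every term contains `u i`
and `v i` once each. The expectation is thus linear in the inner product and keeps its sign. -/
lemma trace_exchange_mul_vecMulVec (u v : ι → Bool) :
    (exchange ι * Matrix.vecMulVec (fun i : Option ι × Option ι => signState u i.1 * signState v i.2)
      (star fun i : Option ι × Option ι => signState u i.1 * signState v i.2)).trace =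
      ((1 / (2 * Fintype.card ι) * ∑ i, bitSign (u i) * bitSign (v i) : ℝ) : ℂ) := by
  simp only [Matrix.trace, Matrix.diag_apply, exchange_mul_apply, Matrix.vecMulVec_apply,
    Pi.star_apply, Fintype.sum_prod_type, Fintype.sum_option, Prod.swap_prod_mk, signState,
    Option.elim, Option.isNone_none, Option.isNone_some, Bool.xor_false, Bool.xor_true,
    Bool.not_true, Bool.not_false, Bool.false_eq_true, if_true, if_false, Complex.star_def,
    ← Complex.ofReal_mul, Complex.conj_ofReal, Finset.sum_const_zero, add_zero, zero_add]
  simp only [← Complex.ofReal_sum, ← Complex.ofReal_add]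
  congr 1
  rw [Finset.mul_sum, ← Finset.sum_add_distrib]
  refine Finset.sum_congr rfl fun i _ => ?_
  have h1 : √(1 / 2 : ℝ) * √(1 / 2 : ℝ) = 1 / 2 := Real.mul_self_sqrt (by norm_num)
  have h2 : √(1 / (2 * Fintype.card ι) : ℝ) * √(1 / (2 * Fintype.card ι) : ℝ) =
    1 / (2 * Fintype.card ι) := Real.mul_self_sqrt (by positivity)
  linear_combination 2 * bitSign (u i) * bitSign (v i) * (√(1 / (2 * Fintype.card ι) : ℝ) *
    √(1 / (2 * Fintype.card ι) : ℝ) * h1 + 1 / 2 * h2)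

lemma trace_exchangeMeasurement_mul_vecMulVec [Nonempty ι] (u v : ι → Bool) (b : Bool) :
    (exchangeMeasurement ι b *
      Matrix.vecMulVec (fun i : Option ι × Option ι => signState u i.1 * signState v i.2)
      (star fun i : Option ι × Option ι => signState u i.1 * signState v i.2)).trace =
      ((1 / 2 * (1 + bitSign b * (1 / (2 * Fintype.card ι) *
        ∑ i, bitSign (u i) * bitSign (v i))) : ℝ) : ℂ) := by
  have h1 : (Matrix.vecMulVec (fun i : Option ι × Option ι => signState u i.1 * signState v i.2)
      (star fun i : Option ι × Option ι => signState u i.1 * signState v i.2)).trace = 1 := by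
    rw [← one_mul (1 : ℂ)]
    nth_rewrite 1 [← sum_signState u]
    rw [← sum_signState v, Finset.sum_mul_sum, ← Fintype.sum_prod_type']
    simp only [Matrix.trace, Matrix.diag_apply, Matrix.vecMulVec_apply, Pi.star_apply, star_mul']
    exact Finset.sum_congr rfl fun i _ => by ring
  rw [exchangeMeasurement, Matrix.smul_mul, Matrix.trace_smul, Matrix.add_mul, Matrix.trace_add,
    Matrix.smul_mul, Matrix.trace_smul, Matrix.one_mul, h1, trace_exchange_mul_vecMulVec]
  push_cast
  simp only [smul_eq_mul]

end Exchange

/-! ### Quantum fingerprints from sampled coins -/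

section Fingerprints

variable {X Y : Type}

lemma abs_bitSign (b : Bool) : |bitSign b| = 1 := by
  cases b <;> simp [bitSign]

lemma quantumSMP_le_of_hasXorSampling [Fintype X] [Fintype Y] {f : X → Y → Bool} {t δ : ℝ}
    (ht : 0 < t) (ht1 : t ≤ 1) (hf : HasXorSampling f t) {m q : ℕ} (hq : 1 ≤ q)
    (hcard : Fintype.card (X × Y) * Real.exp (-(t ^ 2 / 16)) ^ (2 ^ q - 1) < 1)
    (hδ : Real.exp (-(m * (t / 4) ^ 2) / 2) / 2 ≤ δ) :
    quantumSMP δ f ≤ ((m * q + m * q : ℕ) : ℕ∞) := by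
  obtain ⟨Ω, _, μ, a, b, hμ, hμ1, hbias⟩ := hf
  have h2q : 2 ≤ 2 ^ q := by
    calc 2 = 2 ^ 1 := rfl
      _ ≤ 2 ^ q := Nat.pow_le_pow_right (by norm_num) hq
  -- With the reference state `none`, `N` samples fill exactly the `2 ^ q` basis states of `q`
  -- qubits.
  set N := 2 ^ q - 1 with hN
  have : Nonempty (Fin N) := ⟨⟨0, by omega⟩⟩
  have hN0 : (0 : ℝ) < N := by exact_mod_cast (by omega : 0 < N)
  obtain ⟨r, hr⟩ := exists_samples (ι := Fin N) hμ hμ1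
    (z := fun ω (j : X × Y) => bitSign (a ω j.1 ^^ b ω j.2) * bitSign (f j.1 j.2))
    (fun ω j => by rw [abs_mul, abs_bitSign, abs_bitSign, one_mul]) ht ht1
    (fun j => (hbias j.1 j.2).trans (le_of_eq (Finset.sum_congr rfl fun ω _ => by
      cases (a ω j.1 ^^ b ω j.2) <;> cases f j.1 j.2 <;> simp [bitSign])))
    (by rwa [Fintype.card_fin])
  have hxor : ∀ c d, bitSign (c ^^ d) = bitSign c * bitSign d := by
    intro c d
    cases c <;> cases d <;> simp [bitSign]
  obtain ⟨P, hP⟩ := exists_protocol_majority (m := m) (q := q) (J := Option (Fin N))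
    (by rw [Fintype.card_option, Fintype.card_fin]; omega)
    (fun x : X => sum_signState fun i => a (r i) x)
    (fun y : Y => sum_signState fun i => b (r i) y)
    exchangeMeasurement_posSemidef sum_exchangeMeasurement
    (fun x y c => trace_exchangeMeasurement_mul_vecMulVec _ _ c)
  refine sInf_le ⟨m * q, m * q, P, fun x y => ?_, rfl⟩
  rw [hP]
  simp only [Fintype.card_fin]
  set S : ℝ := 1 / (2 * N) * ∑ i, bitSign (a (r i) x) * bitSign (b (r i) y) with hS
  have hS1 : |S| ≤ 1 := by
    rw [hS, abs_mul, abs_of_pos (by positivity)]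
    have h : |∑ i, bitSign (a (r i) x) * bitSign (b (r i) y)| ≤ N := by
      refine (Finset.abs_sum_le_sum_abs _ _).trans (le_of_eq ?_)
      simp [abs_mul, abs_bitSign]
    calc 1 / (2 * N) * |∑ i, bitSign (a (r i) x) * bitSign (b (r i) y)| ≤ 1 / (2 * N) * N := by
          gcongr
      _ ≤ 1 := by
          field_simp
          norm_num
  -- Sampling leaves empirical bias `t / 2`, and the reference amplitude halves it again.
  have hS2 : t / 4 ≤ bitSign (f x y) * S := by
    have h := hr (x, y)
    simp only [hxor, Fintype.card_fin, ← Finset.sum_mul] at h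
    rw [hS, ← mul_assoc, mul_comm (bitSign _), mul_assoc, mul_comm (bitSign _), one_div,
      ← div_eq_inv_mul, le_div_iff₀ (by positivity)]
    linarith
  refine le_trans (by linarith) (le_sum_majority (p := fun c => 1 / 2 * (1 + bitSign c * S))
    (t := t / 4) (b := f x y) (fun c => ?_) ?_ (by positivity) ?_)
  · have := abs_le.1 hS1
    cases c <;> simp [bitSign] <;> linarith
  · rw [Fintype.sum_bool]
    simp only [bitSign, if_true, Bool.false_eq_true, if_false]
    ring
  · refine hS2.trans (le_of_eq ?_)
    cases f x y <;> simp [bitSign] <;> ring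

end Fingerprints

/-! ### Choice of parameters -/

section Bounds

lemma toENNReal_le_ofReal {c : ℕ∞} {n : ℕ} {s : ℝ} (hc : c ≤ (n : ℕ∞)) (hn : (n : ℝ) ≤ s) :
    ((c : ℕ∞) : ℝ≥0∞) ≤ ENNReal.ofReal s := by
  calc ((c : ℕ∞) : ℝ≥0∞) ≤ ((n : ℕ∞) : ℝ≥0∞) := ENat.toENNReal_le.2 hc
    _ = ENNReal.ofReal n := by rw [ENat.toENNReal_coe, ENNReal.ofReal_natCast]
    _ ≤ ENNReal.ofReal s := ENNReal.ofReal_le_ofReal hn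

/-- The factor `1 / 2` in the majority error buys a slack of `log 2` in the exponent. -/
lemma exp_neg_div_two_le {δ s : ℝ} (hδ : 0 < δ) (hs : Real.log (1 / δ) - Real.log 2 ≤ s) :
    Real.exp (-s) / 2 ≤ δ := by
  rw [one_div, Real.log_inv] at hs
  have : Real.exp (-s) ≤ Real.exp (Real.log δ + Real.log 2) := Real.exp_le_exp.2 (by linarith)
  rw [Real.exp_add, Real.exp_log hδ, Real.exp_log (by norm_num)] at this
  linarith

variable {X Y : Type} [Fintype X] [Fintype Y] [DecidableEq X] [DecidableEq Y] [Nonempty X]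
  [Nonempty Y]

lemma pubSMP_le (f : X → Y → Bool) {ε δ : ℝ} (hε : 0 ≤ ε) (hε' : ε < 1 / 2) (hδ : 0 < δ)
    (hδ' : δ < 1 / 2) :
    ((pubSMP δ f : ℕ∞) : ℝ≥0∞) ≤ ENNReal.ofReal
      (4 * (nuTildeApproxSign ε (signMatrix f) / (1 - 2 * ε)) ^ 2 * Real.log (1 / δ)) := by
  set Λ := nuTildeApproxSign ε (signMatrix f) with hΛ
  have hΛ1 : 1 ≤ Λ := one_le_nuTildeApproxSign hε _
  set R := 1 - 2 * ε with hR
  have hR0 : 0 < R := by linarith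
  have hR1 : R ≤ 1 := by linarith
  set L := Real.log (1 / δ) with hL
  have hL0 : 0 < L := Real.log_pos (by rw [lt_div_iff₀ hδ]; linarith)
  set k := ⌊2 * (Λ / R) ^ 2 * L⌋₊ with hk
  have hT : 1 ≤ Λ / R := by
    rw [le_div_iff₀ hR0]
    linarith
  have hkle : (k : ℝ) ≤ 2 * (Λ / R) ^ 2 * L := Nat.floor_le (by positivity)
  have hklt : 2 * (Λ / R) ^ 2 * L < k + 1 := Nat.lt_floor_add_one _
  have hlim : L - Real.log 2 < k * (R / Λ) ^ 2 / 2 := by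
    have h2 : (R / Λ) ^ 2 = ((Λ / R) ^ 2)⁻¹ := by rw [← inv_pow, inv_div]
    have hT2 : 1 ≤ (Λ / R) ^ 2 := one_le_pow₀ hT
    rw [h2, ← div_eq_mul_inv, div_div, lt_div_iff₀ (by positivity)]
    nlinarith [Real.log_two_gt_d9]
  -- The strategy is available only for `Λ' > Λ`, as the infimum is not shown to be attained. The
  -- strict inequality at `Λ` persists slightly to its right, so no constant is lost.
  have hev : ∀ᶠ Λ' in nhdsWithin Λ (Set.Ioi Λ), L - Real.log 2 < k * (R / Λ') ^ 2 / 2 := by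
    have hc : ContinuousAt (fun Λ' : ℝ => k * (R / Λ') ^ 2 / 2) Λ := by
      have : Λ ≠ 0 := by positivity
      fun_prop (disch := assumption)
    exact (hc.eventually_const_lt hlim).filter_mono nhdsWithin_le_nhds
  obtain ⟨Λ', h1, h2⟩ := (hev.and self_mem_nhdsWithin).exists
  have h2 : Λ < Λ' := h2
  refine toENNReal_le_ofReal (pubSMP_le_of_hasXorSampling (m := k) (t := R / Λ') ?_
    (hasXorSampling_of_nuTildeApproxSign_lt hε hε' h2) ?_) ?_
  · exact div_nonneg hR0.le (by linarith)
  · rw [neg_div]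
    exact exp_neg_div_two_le hδ h1.le
  · push_cast
    linarith

lemma quantumSMP_le (f : X → Y → Bool) {ε δ : ℝ} (hε : 0 ≤ ε) (hε' : ε < 1 / 2) (hδ : 0 < δ)
    (hδ' : δ < 1 / 2) {n : ℕ} (hn : 2 ≤ n) (hcard : Fintype.card (X × Y) ≤ 2 ^ n * 2 ^ n) :
    ((quantumSMP δ f : ℕ∞) : ℝ≥0∞) ≤ ENNReal.ofReal (5200 * (Real.log n *
      (nuTildeApproxSign ε (signMatrix f) / (1 - 2 * ε)) ^ 4 * Real.log (1 / δ))) := by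
  set Λ := nuTildeApproxSign ε (signMatrix f) with hΛ
  have hΛ1 : 1 ≤ Λ := one_le_nuTildeApproxSign hε _
  set R := 1 - 2 * ε with hR
  have hR0 : 0 < R := by linarith
  have hR1 : R ≤ 1 := by linarith
  set T := Λ / R with hTdef
  have hT : 1 ≤ T := by
    rw [hTdef, le_div_iff₀ hR0]
    linarith
  have hT2 : 1 ≤ T ^ 2 := one_le_pow₀ hT
  have hlog2 := Real.log_two_gt_d9
  have hlog2' := Real.log_two_lt_d9
  set L := Real.log (1 / δ) with hL
  have hL2 : Real.log 2 ≤ L := Real.log_le_log (by norm_num) (by rw [le_div_iff₀ hδ]; linarith)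
  have hL0 : 0 < L := by linarith
  have hn' : (2 : ℝ) ≤ n := by exact_mod_cast hn
  set ℓ := Real.log n with hℓ
  have hℓ2 : Real.log 2 ≤ ℓ := Real.log_le_log (by norm_num) hn'
  have ht : R / (2 * Λ) = 1 / (2 * T) := by
    rw [hTdef]
    field_simp
  -- Constants do not matter here, so `2 * Λ` serves as the value strictly above the infimum.
  have hf : HasXorSampling f (1 / (2 * T)) := by
    rw [← ht]
    exact hasXorSampling_of_nuTildeApproxSign_lt hε hε' (by linarith)
  -- Each copy has bias `1 / (8 T)`, so the exponent of the majority error is `m / (128 T²)`.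
  set m := ⌈128 * T ^ 2 * L⌉₊ with hm
  have hm1 : 128 * T ^ 2 * L ≤ m := Nat.le_ceil _
  have hm2 : (m : ℝ) ≤ 130 * (T ^ 2 * L) := by
    have h := (Nat.ceil_lt_add_one (a := 128 * T ^ 2 * L) (by positivity)).le
    have : 1 ≤ 2 * (T ^ 2 * L) := by nlinarith
    linarith
  have hV : 0 < 130 * (n * T ^ 2) := by positivity
  -- The union bound over at most `4 ^ n ≤ exp (2 n)` input pairs needs `2 ^ q - 1 > 128 n T²`; the
  -- value 130 also absorbs the `1`.
  set q := ⌈Real.log (130 * (n * T ^ 2)) / Real.log 2⌉₊ with hq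
  have hlogV : Real.log (130 * (n * T ^ 2)) ≤ 8 * Real.log 2 + ℓ + T ^ 2 := by
    have h1 : Real.log 130 ≤ 8 * Real.log 2 := by
      rw [← Real.log_rpow (by norm_num)]
      exact Real.log_le_log (by norm_num) (by norm_num)
    have h2 := Real.log_le_self (x := T ^ 2) (by positivity)
    rw [Real.log_mul (by norm_num) (by positivity), Real.log_mul (by positivity) (by positivity)]
    linarith
  have hV0 : 0 < Real.log (130 * (n * T ^ 2)) := Real.log_pos (by nlinarith)
  have hq1 : 1 ≤ q := Nat.one_le_ceil_iff.2 (by positivity)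
  have hqV : 130 * (n * T ^ 2) ≤ 2 ^ q := by
    have h : Real.log (130 * (n * T ^ 2)) ≤ q * Real.log 2 := by
      rw [← div_le_iff₀ (by positivity)]
      exact Nat.le_ceil _
    rwa [← Real.log_pow, Real.log_le_log_iff hV (by positivity)] at h
  -- The crude step `log (T²) ≤ T²` is affordable: the copies contribute a factor `T²` and the
  -- target is `T ^ 4`.
  have hq2 : (q : ℝ) ≤ 20 * (ℓ * T ^ 2) := by
    have h := (Nat.ceil_lt_add_one (a := Real.log (130 * (n * T ^ 2)) / Real.log 2)
      (by positivity)).le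
    refine h.trans ?_
    have h' : Real.log (130 * (n * T ^ 2)) / Real.log 2 ≤ 8 + (ℓ + T ^ 2) / 0.69 := by
      rw [div_le_iff₀ (by positivity)]
      have : ℓ + T ^ 2 ≤ (ℓ + T ^ 2) / 0.69 * Real.log 2 := by
        rw [div_mul_eq_mul_div, le_div_iff₀ (by norm_num)]
        have : 0 < ℓ + T ^ 2 := by positivity
        nlinarith
      linarith
    have h1 : 0.69 * T ^ 2 ≤ ℓ * T ^ 2 := by gcongr; linarith
    have h2 : ℓ ≤ ℓ * T ^ 2 := le_mul_of_one_le_right (by linarith) hT2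
    have h3 : (ℓ + T ^ 2) / 0.69 ≤ (ℓ * T ^ 2 + ℓ * T ^ 2 / 0.69) / 0.69 := by
      gcongr
      rw [le_div_iff₀ (by norm_num)]
      linarith
    norm_num at h3 h' ⊢
    linarith
  refine toENNReal_le_ofReal (quantumSMP_le_of_hasXorSampling (m := m) (q := q)
    (t := 1 / (2 * T)) (by positivity) ?_ hf hq1 ?_ ?_) ?_
  · rw [div_le_one (by positivity)]
    linarith
  · have hpow : ((2 ^ q - 1 : ℕ) : ℝ) = 2 ^ q - 1 := by
      rw [Nat.cast_sub Nat.one_le_two_pow]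
      push_cast
      rfl
    have hcard' : (Fintype.card (X × Y) : ℝ) ≤ Real.exp (2 * n) := by
      calc (Fintype.card (X × Y) : ℝ) ≤ 2 ^ n * 2 ^ n := by exact_mod_cast hcard
        _ ≤ Real.exp 1 ^ n * Real.exp 1 ^ n := by
            have : (2 : ℝ) ≤ Real.exp 1 := by linarith [Real.exp_one_gt_d9]
            gcongr
        _ = Real.exp (2 * n) := by
            rw [← Real.exp_nat_mul, ← Real.exp_add]
            congr 1
            ring
    rw [← Real.exp_nat_mul, hpow]
    calc (Fintype.card (X × Y) : ℝ) * Real.exp ((2 ^ q - 1) * -((1 / (2 * T)) ^ 2 / 16))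
        ≤ Real.exp (2 * n) * Real.exp ((2 ^ q - 1) * -((1 / (2 * T)) ^ 2 / 16)) := by gcongr
      _ = Real.exp (2 * n + (2 ^ q - 1) * -((1 / (2 * T)) ^ 2 / 16)) := (Real.exp_add _ _).symm
      _ < 1 := by
          rw [Real.exp_lt_one_iff]
          have h : (1 / (2 * T)) ^ 2 / 16 = 1 / (64 * T ^ 2) := by
            field_simp
            norm_num
          rw [h, mul_neg, mul_one_div, ← sub_eq_add_neg, sub_neg, lt_div_iff₀ (by positivity)]
          nlinarith
  · rw [neg_div]
    refine exp_neg_div_two_le hδ ?_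
    have h : m * (1 / (2 * T) / 4) ^ 2 / 2 = m / (128 * T ^ 2) := by
      field_simp
      ring
    rw [h]
    refine le_trans (by linarith) ((le_div_iff₀ (by positivity)).2 ?_ : L ≤ _)
    linarith
  · push_cast
    calc (m * q + m * q : ℝ) = 2 * (m * q) := by ring
      _ ≤ 2 * (130 * (T ^ 2 * L) * (20 * (ℓ * T ^ 2))) := by gcongr
      _ = 5200 * (ℓ * T ^ 4 * L) := by ring

end Bounds

end SMP

theorem mainTheorem8 :
    (∀ (n : ℕ) (f : (Fin n → Bool) → (Fin n → Bool) → Bool) (ε δ : ℝ),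
      0 ≤ ε → ε < 1 / 2 → 0 < δ → δ < 1 / 2 →
        ((SMP.pubSMP δ f : ℕ∞) : ℝ≥0∞) ≤
          ENNReal.ofReal
            (4 * (SMP.nuTildeApproxSign ε (SMP.signMatrix f) / (1 - 2 * ε)) ^ 2
              * Real.log (1 / δ))) ∧
    (∃ K : ℝ, 0 < K ∧
      ∀ (n : ℕ) (f : (Fin n → Bool) → (Fin n → Bool) → Bool) (ε δ : ℝ),
        2 ≤ n → 0 ≤ ε → ε < 1 / 2 → 0 < δ → δ < 1 / 2 →
          ((SMP.quantumSMP δ f : ℕ∞) : ℝ≥0∞) ≤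
            ENNReal.ofReal
              (K * (Real.log n
                * (SMP.nuTildeApproxSign ε (SMP.signMatrix f) / (1 - 2 * ε)) ^ 4
                * Real.log (1 / δ)))) := by
  refine ⟨fun n f ε δ hε hε' hδ hδ' => SMP.pubSMP_le f hε hε' hδ hδ', 5200, by norm_num,
    fun n f ε δ hn hε hε' hδ hδ' => SMP.quantumSMP_le f hε hε' hδ hδ' hn ?_⟩
  simp
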